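/- Let $H$ be a real or complex Hilbert space with scalar field $\mathbb F\in\{\mathbb R,\mathbb C\}$. A nest on $H$ is a collection $\mathcal N$ of closed subspaces of $H$ that contains $\{0\}$ and $H$, is closed under arbitrary intersections and arbitrary closed linear spans, and is totally ordered by inclusion. Its nest algebra is $\mathrm{Alg}\,\mathcal N=\{T\in B(H): T(M)\subseteq M \text{ for all } M\in\mathcal N\}$, with the operator norm, where $B(H)$ is the algebra of bounded linear operators on $H$. Let $\mathcal N$ be a nest on $H$, let $N\in\mathcal N$ with $N\neq\{0\}$ and $N\neq H$, and let $P_N\in\mathrm{Alg}\,\mathcal N$ be the orthogonal projection of $H$ onto $N$. Let $\delta:\mathrm{Alg}\,\mathcal N\to\mathrm{Alg}\,\mathcal N$ be a continuous $\mathbb F$-linear map, and let $I$ be the identity operator on $H$. Then \[ A,B\in\mathrm{Alg}\,\mathcal N,\quad AB+BA=P_N\ \Longrightarrow\ 2A\delta(B)+2B\delta(A)=\delta(P_N) \] if and only if $\delta(A)=A\delta(I)$ for all $A\in\mathrm{Alg}\,\mathcal N$ and $P_N\delta(I)=0$. -/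

import Mathlib

/-- A subspace lattice on `H`: a collection of closed subspaces that contains `{0}` and `H` and is
closed under arbitrary intersections (`sInf`) and arbitrary closed linear spans (`sSup`). -/
structure IsSubspaceLattice {𝕜 H : Type*} [RCLike 𝕜] [NormedAddCommGroup H]
    [InnerProductSpace 𝕜 H] (ℒ : Set (ClosedSubmodule 𝕜 H)) : Prop where
  bot_mem : ⊥ ∈ ℒ
  top_mem : ⊤ ∈ ℒ
  sInf_mem : ∀ S : Set (ClosedSubmodule 𝕜 H), S ⊆ ℒ → sInf S ∈ ℒ
  sSup_mem : ∀ S : Set (ClosedSubmodule 𝕜 H), S ⊆ ℒ → sSup S ∈ ℒ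

/-- A nest: a subspace lattice that is totally ordered by inclusion. -/
structure IsNest {𝕜 H : Type*} [RCLike 𝕜] [NormedAddCommGroup H]
    [InnerProductSpace 𝕜 H] (𝒩 : Set (ClosedSubmodule 𝕜 H)) : Prop
    extends IsSubspaceLattice 𝒩 where
  total : ∀ M ∈ 𝒩, ∀ N ∈ 𝒩, M ≤ N ∨ N ≤ M

/-- `Alg ℒ`: the algebra of all bounded operators that leave every member of `ℒ` invariant. As a
subalgebra of `H →L[𝕜] H` it carries the operator norm. -/
def algOf {𝕜 H : Type*} [RCLike 𝕜] [NormedAddCommGroup H] [InnerProductSpace 𝕜 H]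
    (ℒ : Set (ClosedSubmodule 𝕜 H)) : Subalgebra 𝕜 (H →L[𝕜] H) where
  carrier := {T | ∀ L ∈ ℒ, ∀ x ∈ L, T x ∈ L}
  mul_mem' := fun hS hT L hL x hx => hS L hL _ (hT L hL x hx)
  add_mem' := fun hS hT L hL x hx => L.toSubmodule.add_mem (hS L hL x hx) (hT L hL x hx)
  algebraMap_mem' := fun c L _ x hx => by
    have h : (algebraMap 𝕜 (H →L[𝕜] H) c) x = c • x := by
      simp [Algebra.algebraMap_eq_smul_one]
    rw [h]
    exact L.toSubmodule.smul_mem c hx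

/-- The orthogonal projection of `H` onto a member `N` of a nest leaves every member of the nest
invariant. -/
theorem starProjection_mem_algOf {𝕜 H : Type*} [RCLike 𝕜] [NormedAddCommGroup H]
    [InnerProductSpace 𝕜 H] [CompleteSpace H] {𝒩 : Set (ClosedSubmodule 𝕜 H)} (h𝒩 : IsNest 𝒩)
    {N : ClosedSubmodule 𝕜 H} (hN : N ∈ 𝒩) :
    N.toSubmodule.starProjection ∈ algOf 𝒩 := by
  intro M hM x hx
  rcases h𝒩.total M hM N hN with h | h
  · rw [Submodule.starProjection_eq_self_iff.mpr (h hx)]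
    exact hx
  · exact h (Submodule.starProjection_apply_mem N.toSubmodule x)

/-- The orthogonal projection `P_N` of `H` onto a member `N` of a nest, as an element of the nest
algebra. -/
noncomputable def nestProj {𝕜 H : Type*} [RCLike 𝕜] [NormedAddCommGroup H]
    [InnerProductSpace 𝕜 H] [CompleteSpace H] {𝒩 : Set (ClosedSubmodule 𝕜 H)} (h𝒩 : IsNest 𝒩)
    {N : ClosedSubmodule 𝕜 H} (hN : N ∈ 𝒩) : algOf 𝒩 :=
  ⟨N.toSubmodule.starProjection, starProjection_mem_algOf h𝒩 hN⟩

/-!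
Write `p = P_N`, `q = 1 - p` and `R` for the nest algebra. Since `N` is invariant, `q R p = 0`, so
`R` is block triangular with respect to `p`. After rescaling, the hypothesis says that
`a δ(b) + b δ(a) = δ(p)` whenever `a b + b a = 2 p`; the pair `p, p` gives `δ(p) = 0`.

On the corner `p R p` the relation holds for inverse pairs, and Hua's trick turns it into
`p δ(u²) = 2 u δ(u)` (`mul_map_sq_of_inverses`, `mul_map_sq`): `p δ(·)` is a left Jordan derivation on
the corner. Such a map vanishes at idempotents. Every rank-one operator of the corner is a linear
combination of idempotents (`map_rankOne_eq_zero`), so the map vanishes there too, and as the rank-one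
operators separate the vectors of `N` (`exists_rankOne_apply_ne_zero`), the polarized square rule
shows that it vanishes on the whole corner (`map_corner_of_nest`). A further choice of pairs gives
`δ = 0` on the corner (`map_corner_eq_zero`).

The off-diagonal and lower blocks are then determined by pairs with components in `p R q` and
`q R q`, together with the faithfulness of `p R q` on the complement of `N`
(`map_eq_mul_map_one`, `nestProj_complement_faithful`).
-/

/-! ### Jordan pairs with respect to an idempotent of a ring -/

section Ring

variable {R : Type*} [Ring R] {p : R} {δ : R →+ R}

theorem map_idempotent_eq_zero (hp : p * p = p)
    (hδ : ∀ a b : R, a * b + b * a = p + p → a * δ b + b * δ a = δ p) : δ p = 0 := by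
  have h1 := hδ p p (by rw [hp])
  have h2 : p * δ p = 0 := by
    have := congrArg (p * ·) h1
    simpa only [mul_add, ← mul_assoc, hp, add_eq_left] using this
  rw [← h1, h2, add_zero]

/-- Hua's trick: if `u` and `p - u` are invertible in the corner of `p`, with inverses `v` and `w`,
then `v + w` is the inverse of `u - u * u`, and comparing the relations at these three inverse pairs
shows that `p * δ ·` satisfies the square rule of a left Jordan derivation at `u`. The relation
`p * δ v = -v² δ u` plays the role of the derivative of `u⁻¹`. -/
theorem mul_map_sq_of_inverses
    (hδ : ∀ a b : R, a * b + b * a = p + p → a * δ b + b * δ a = 0) (h0 : δ p = 0)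
    {u v w : R} (hup : u * p = u) (hpu : p * u = u) (hv : p * v = v) (hw : p * w = w)
    (huv : u * v = p) (hvu : v * u = p)
    (huw : (p - u) * w = p) (hwu : w * (p - u) = p) :
    p * δ (u * u) = u * δ u + u * δ u := by
  have hv' : v * p = v := by rw [← huv, ← mul_assoc, hvu, hv]
  have hw' : w * p = w := by rw [← huw, ← mul_assoc, hwu, hw]
  have k1 : u * w = w - p := by rw [sub_mul, hw] at huw; rw [← huw]; abel
  have k2 : w * u = w - p := by rw [mul_sub, hw'] at hwu; rw [← hwu]; abel
  have e1 := hδ u v (by rw [huv, hvu])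
  have e2 := hδ (p - u) w (by rw [huw, hwu])
  have e3 := hδ (u - u * u) (v + w) (by
    simp only [mul_add, add_mul, mul_sub, sub_mul, mul_assoc, huv, hvu, k1, k2, hup]
    simp only [← mul_assoc, hvu, k2, hpu, sub_mul]
    abel)
  simp only [map_sub, map_add, h0, zero_sub, mul_neg] at e2 e3
  have f1 : p * δ v = -(v * (v * δ u)) := by
    have := congrArg (v * ·) e1
    simp only [mul_add, mul_zero] at this
    rw [← mul_assoc, hvu] at this
    exact eq_neg_of_add_eq_zero_left this
  have f2 : p * δ w = w * (w * δ u) := by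
    have := congrArg (w * ·) e2
    simp only [mul_add, mul_zero, mul_neg] at this
    rw [← mul_assoc, hwu] at this
    exact eq_of_sub_eq_zero (by rw [sub_eq_add_neg, this])
  have g1 : u * δ v = - (v * δ u) := eq_neg_of_add_eq_zero_left e1
  have g2 : u * δ w = w * (w * δ u) - w * δ u := by
    rw [sub_mul, f2] at e2
    rw [← sub_eq_zero, ← neg_eq_zero, ← e2]; abel
  -- multiply `e3` by `u * (p - u)`, the corner inverse of `v + w`
  have e4 := congrArg (fun x => (u - u * u) * x) e3
  simp only [mul_add, add_mul, mul_sub, sub_mul, mul_zero] at e4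
  simp only [mul_assoc, g1, g2] at e4
  simp only [mul_neg, mul_sub] at e4
  have r1 : ∀ x, u * (v * x) = p * x := fun x => by rw [← mul_assoc, huv]
  have r2 : ∀ x, u * (w * x) = w * x - p * x := fun x => by rw [← mul_assoc, k1, sub_mul]
  have r3 : ∀ x, u * (p * x) = u * x := fun x => by rw [← mul_assoc, hup]
  simp only [r1, r2, r3, mul_sub] at e4
  rw [← sub_eq_zero, ← neg_eq_zero, ← e4]
  abel

theorem mul_map_idempotent_eq_zero
    (hsq : ∀ u, u * p = u → p * u = u → p * δ (u * u) = u * δ u + u * δ u)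
    {e : R} (he : e * e = e) (hep : e * p = e) (hpe : p * e = e) : p * δ e = 0 := by
  have h1 := hsq e hep hpe
  rw [he] at h1
  have h2 := congrArg (e * ·) h1
  simp only [mul_add, ← mul_assoc, he, hep, left_eq_add] at h2
  rw [h1, h2, add_zero]

/-- The polarized form of the square rule of a left Jordan derivation. -/
theorem mul_map_jordan
    (hsq : ∀ u, u * p = u → p * u = u → p * δ (u * u) = u * δ u + u * δ u)
    {u v : R} (hup : u * p = u) (hpu : p * u = u) (hvp : v * p = v) (hpv : p * v = v) :
    p * δ (u * v + v * u) = u * δ v + u * δ v + (v * δ u + v * δ u) := by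
  have h1 := hsq (u + v) (by rw [add_mul, hup, hvp]) (by rw [mul_add, hpu, hpv])
  have h2 := hsq u hup hpu
  have h3 := hsq v hvp hpv
  simp only [mul_add, add_mul, map_add, h2, h3] at h1 ⊢
  rw [← sub_eq_zero] at h1 ⊢
  rw [← h1]
  abel

theorem mul_map_complement (hp : p * p = p)
    (hδ : ∀ a b : R, a * b + b * a = p + p → a * δ b + b * δ a = 0) (h0 : δ p = 0)
    {d : R} (hpd : p * d = 0) (hdp : d * p = 0) : p * δ d = 0 := by
  have h1 := hδ (p + d) p (by simp only [mul_add, add_mul, hp, hpd, hdp, add_zero])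
  simpa only [map_add, h0, mul_zero, zero_add] using h1

/-- The block-triangular argument. Write `q = 1 - p`. Once `δ` vanishes on the corner of `p`, the pairs
`p - z - z * d + d`, `p + z` with `z` in `p R q` and `d` in `q R q` give `δ (z * d) = z * δ d`, and
faithfulness of the left action of `p R q` on `q R` determines `δ` on `q R q`. -/
theorem map_eq_mul_map_one (hp : p * p = p)
    (htri : ∀ a : R, p * (a * p) = a * p)
    (hfaith : ∀ b : R, (∀ a : R, p * a * (1 - p) * b = 0) → (1 - p) * b = 0)
    (hδ : ∀ a b : R, a * b + b * a = p + p → a * δ b + b * δ a = 0)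
    (hcorner : ∀ u, u * p = u → p * u = u → δ u = 0) :
    (∀ a, δ a = a * δ 1) ∧ p * δ 1 = 0 := by
  have h0 : δ p = 0 := hcorner p hp hp
  obtain ⟨q, hq⟩ : ∃ q, q = 1 - p := ⟨_, rfl⟩
  have hpq : p * q = 0 := by rw [hq, mul_sub, mul_one, hp, sub_self]
  have hqp : q * p = 0 := by rw [hq, sub_mul, one_mul, hp, sub_self]
  have hqq : q * q = q := by nth_rw 1 [hq]; rw [sub_mul, one_mul, hpq, sub_zero]
  have h1 : δ 1 = δ q := by rw [hq, map_sub, h0, sub_zero]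
  have hpδ : ∀ d, p * d = 0 → d * p = 0 → p * δ d = 0 := fun d =>
    mul_map_complement hp hδ h0
  -- the basic relation, from the pair `p - z - z * d + d`, `p + z`
  have main : ∀ z d, p * z = z → z * p = 0 → p * d = 0 → d * p = 0 →
      (p - z - z * d + d) * δ z + (p + z) * δ (d - z - z * d) = 0 := by
    intro z d hz hz' hd hd'
    have zz : z * z = 0 := by rw [← hz, ← mul_assoc, hz, hz', zero_mul]
    have dz : d * z = 0 := by rw [← hz, ← mul_assoc, hd', zero_mul]
    have h := hδ (p - z - z * d + d) (p + z) (by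
      simp only [mul_add, add_mul, mul_sub, sub_mul, mul_assoc, hd', dz, zz, hz, hz', hp, mul_zero]
      simp only [← mul_assoc, hz, zz, hd, zero_mul]
      abel)
    have e : p - z - z * d + d = p + (d - z - z * d) := by abel
    rw [map_add, h0, zero_add] at h
    rw [e] at h ⊢
    rwa [map_add, h0, zero_add] at h
  have hqδ : ∀ z, p * z = z → z * p = 0 → q * δ z = 0 := by
    intro z hz hz'
    -- multiplied by `q`, the basic relation with `d = q` reduces to `q * δ z = 0`
    have h := congrArg (q * ·) (main z q hz hz' hpq hqp)
    have hqz : q * z = 0 := by rw [← hz, ← mul_assoc, hqp, zero_mul]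
    simpa only [mul_add, add_mul, mul_sub, sub_mul, ← mul_assoc, hqp, hqz, hqq, zero_mul, zero_add,
      sub_zero, mul_zero, add_zero, sub_self] using h
  have hδz : ∀ z, p * z = z → z * p = 0 → p * δ z = δ z := by
    intro z hz hz'
    have h := hqδ z hz hz'
    rw [hq, sub_mul, one_mul, sub_eq_zero] at h
    exact h.symm
  have hmod : ∀ z d, p * z = z → z * p = 0 → p * d = 0 → d * p = 0 → δ (z * d) = z * δ d := by
    intro z d hz hz' hd hd'
    have h := main z d hz hz' hd hd'
    have k1 := hδz z hz hz'
    have k2 := hδz (z * d) (by rw [← mul_assoc, hz]) (by rw [mul_assoc, hd', mul_zero])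
    have k3 : z * δ z = 0 := by rw [← k1, ← mul_assoc, hz', zero_mul]
    have k4 : z * δ (z * d) = 0 := by rw [← k2, ← mul_assoc, hz', zero_mul]
    have k5 : d * δ z = 0 := by rw [← k1, ← mul_assoc, hd', zero_mul]
    simp only [map_sub, mul_sub, sub_mul, add_mul, mul_assoc, k1, k2, k3, k4, k5, hpδ d hd hd',
      mul_zero, sub_zero, add_zero] at h
    rw [← sub_eq_zero, ← neg_eq_zero, ← h]
    abel
  have hzq : ∀ z, z * p = 0 → z * q = z := by
    intro z hz
    rw [hq, mul_sub, hz, mul_one, sub_zero]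
  have hz1 : ∀ z, p * z = z → z * p = 0 → δ z = z * δ q := by
    intro z hz hz'
    rw [← hmod z q hz hz' hpq hqp, hzq z hz']
  have hd1 : ∀ d, p * d = 0 → d * p = 0 → δ d = d * δ q := by
    intro d hd hd'
    have hb : (1 - p) * (δ d - d * δ q) = 0 := by
      refine hfaith _ fun a => ?_
      have hz : p * (p * a * q) = p * a * q := by simp only [← mul_assoc, hp]
      have hz' : p * a * q * p = 0 := by rw [mul_assoc, hqp, mul_zero]
      rw [← hq, mul_sub, ← hmod _ d hz hz' hd hd', hz1 _ (by rw [← mul_assoc, hz])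
        (by rw [mul_assoc, hd', mul_zero]), mul_assoc _ d, sub_self]
    rw [sub_mul, one_mul, mul_sub, ← mul_assoc p d, hd, zero_mul, hpδ d hd hd', sub_zero, sub_zero]
      at hb
    exact sub_eq_zero.mp hb
  have hp1 : p * δ 1 = 0 := by rw [h1, hpδ q hpq hqp]
  refine ⟨fun a => ?_, hp1⟩
  have hu : δ (a * p) = 0 := hcorner _ (by rw [mul_assoc, hp]) (htri a)
  have hz := hz1 (p * a * q) (by simp only [← mul_assoc, hp]) (by rw [mul_assoc, hqp, mul_zero])
  have hd := hd1 (q * a * q) (by simp only [← mul_assoc, hpq, zero_mul])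
    (by rw [mul_assoc, hqp, mul_zero])
  have ha : a = a * p + (p * a * q + q * a * q) := by
    rw [← add_mul, ← add_mul, hq, add_sub_cancel, one_mul, ← mul_add, add_sub_cancel, mul_one]
  have e : a * δ 1 = (p * a * q + q * a * q) * δ q := by
    conv_lhs => rw [ha, add_mul, mul_assoc, hp1, mul_zero, zero_add, h1]
  rw [e]
  conv_lhs => rw [ha, map_add, map_add, hu, hz, hd, zero_add, ← add_mul]

end Ring

/-! ### The corner of an idempotent in a Banach algebra -/

section Algebra

variable {𝕜 R : Type*} [RCLike 𝕜] [NormedRing R] [NormedAlgebra 𝕜 R] [CompleteSpace R] {p : R}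
  {δ : R →ₗ[𝕜] R}

/-- All sufficiently large translates of an element of the corner of `p` are invertible there. -/
theorem exists_inverse_in_corner (hp : p * p = p) {u : R} (hup : u * p = u) (hpu : p * u = u) :
    ∃ k : ℝ, ∀ l : ℝ, k ≤ l → ∃ n : R, n * p = n ∧ p * n = n ∧ ((l : 𝕜) • p - u) * n = p ∧
      n * ((l : 𝕜) • p - u) = p := by
  obtain ⟨k, hk⟩ : ∃ k : ℝ, ‖u‖ * ‖(1 : R)‖ < k := exists_gt _
  have hk0 : 0 ≤ k := (by positivity : 0 ≤ ‖u‖ * ‖(1 : R)‖).trans hk.le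
  refine ⟨k, fun l hl => ?_⟩
  have hu : IsUnit (algebraMap 𝕜 R l - u) := spectrum.mem_resolventSet_of_norm_lt_mul (by
    rw [RCLike.norm_ofReal, abs_of_nonneg (hk0.trans hl)]
    exact hk.trans_le hl)
  obtain ⟨⟨a, n, han, hna⟩, rfl : a = _⟩ := hu
  have hpa : (l : 𝕜) • p - u = p * (algebraMap 𝕜 R l - u) := by
    rw [mul_sub, hpu, ← Algebra.commutes, ← Algebra.smul_def]
  have hap : (l : 𝕜) • p - u = (algebraMap 𝕜 R l - u) * p := by
    rw [sub_mul, hup, ← Algebra.smul_def]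
  generalize algebraMap 𝕜 R l - u = a at *
  have hnp : n * p = p * n := by
    calc n * p = n * (p * a) * n := by rw [mul_assoc, mul_assoc, han, mul_one]
      _ = p * n := by rw [← hpa, hap, ← mul_assoc, hna, one_mul]
  refine ⟨p * n, by rw [mul_assoc, hnp, ← mul_assoc, hp], by rw [← mul_assoc, hp], ?_, ?_⟩
  · rw [hap, mul_assoc, ← mul_assoc p, hp, ← hnp, ← mul_assoc, han, one_mul]
  · rw [← hnp, hpa, mul_assoc, ← mul_assoc p, hp, ← hpa, hap, ← mul_assoc, hna, one_mul]

/-- The square rule is invariant under translating `u` by scalar multiples of `p`, which reduces it to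
the case treated by `mul_map_sq_of_inverses`. -/
theorem mul_map_sq (hp : p * p = p)
    (hδ : ∀ a b : R, a * b + b * a = p + p → a * δ b + b * δ a = 0) (h0 : δ p = 0)
    {u : R} (hup : u * p = u) (hpu : p * u = u) :
    p * δ (u * u) = u * δ u + u * δ u := by
  obtain ⟨k, key⟩ := exists_inverse_in_corner (𝕜 := 𝕜) hp hup hpu
  obtain ⟨v, -, hv, huv, hvu⟩ := key k le_rfl
  obtain ⟨w, -, hw, huw, hwu⟩ := key (k + 1) (by linarith)
  -- apply the invertible case to `u - k • p`
  have e : p - (u - (k : 𝕜) • p) = ((k + 1 : ℝ) : 𝕜) • p - u := by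
    push_cast
    rw [add_smul, one_smul]
    abel
  have h1 := mul_map_sq_of_inverses (p := p) (δ := δ.toAddMonoidHom) (u := u - (k : 𝕜) • p)
    (v := -v) (w := w) hδ h0 (by rw [sub_mul, hup, smul_mul_assoc, hp])
    (by rw [mul_sub, hpu, mul_smul_comm, hp]) (by rw [mul_neg, hv]) hw
    (by rw [mul_neg, ← neg_mul, neg_sub, huv]) (by rw [neg_mul, ← mul_neg, neg_sub, hvu])
    (by rw [e, huw]) (by rw [e, hwu])
  simp only [LinearMap.toAddMonoidHom_coe, mul_sub, sub_mul, map_sub, map_smul, h0, smul_zero,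
    sub_zero, mul_smul_comm, smul_mul_assoc, hup, hpu, hp] at h1
  rw [← sub_eq_zero] at h1 ⊢
  rw [← h1]
  abel

/-- If `p * δ ·` vanishes on the corner of `p`, so does `δ`: for `a` invertible in the corner with inverse
`n`, the pair `a`, `n + (1 - p)` shows that `(1 - p) * δ a = 0`. -/
theorem map_corner_eq_zero (hp : p * p = p)
    (hδ : ∀ a b : R, a * b + b * a = p + p → a * δ b + b * δ a = 0)
    (hcorner : ∀ u, u * p = u → p * u = u → p * δ u = 0)
    (h0 : δ p = 0) {u : R} (hup : u * p = u) (hpu : p * u = u) : δ u = 0 := by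
  obtain ⟨k, key⟩ := exists_inverse_in_corner (𝕜 := 𝕜) hp hup hpu
  obtain ⟨n, hnp, hpn, han, hna⟩ := key k le_rfl
  have e : δ ((k : 𝕜) • p - u) = - δ u := by rw [map_sub, map_smul, h0, smul_zero, zero_sub]
  have hap : ((k : 𝕜) • p - u) * p = (k : 𝕜) • p - u := by rw [sub_mul, smul_mul_assoc, hp, hup]
  have hpa : p * ((k : 𝕜) • p - u) = (k : 𝕜) • p - u := by rw [mul_sub, mul_smul_comm, hp, hpu]
  generalize (k : 𝕜) • p - u = a at *
  have hpq : p * (1 - p) = 0 := by rw [mul_sub, mul_one, hp, sub_self]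
  have hqp : (1 - p) * p = 0 := by rw [sub_mul, one_mul, hp, sub_self]
  have haq : a * (1 - p) = 0 := by rw [← hap, mul_assoc, hpq, mul_zero]
  have hqa : (1 - p) * a = 0 := by rw [← hpa, ← mul_assoc, hqp, zero_mul]
  have h1 := hδ a (n + (1 - p)) (by rw [mul_add, add_mul, han, hna, haq, hqa, add_zero])
  have h2 : a * δ (n + (1 - p)) = 0 := by
    have hc : p * δ (1 - p) = 0 := mul_map_complement (δ := δ.toAddMonoidHom) hp hδ h0 hpq hqp
    rw [← hap, mul_assoc, map_add, mul_add p, hcorner n hnp hpn, hc, add_zero, mul_zero]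
  have h3 : n * δ a = 0 := by rw [← hnp, mul_assoc, hcorner a hap hpa, mul_zero]
  rw [h2, zero_add, add_mul, h3, zero_add, sub_mul, hcorner a hap hpa, sub_zero, one_mul, e] at h1
  exact neg_eq_zero.mp h1

end Algebra

/-! ### Rank-one operators in a nest algebra -/

section Nest

open scoped InnerProductSpace
open InnerProductSpace (rankOne)

variable {𝕜 H : Type*} [RCLike 𝕜] [NormedAddCommGroup H] [InnerProductSpace 𝕜 H]
  {𝒩 : Set (ClosedSubmodule 𝕜 H)} {N : ClosedSubmodule 𝕜 H}

theorem isClosed_algOf : IsClosed (algOf 𝒩 : Set (H →L[𝕜] H)) := by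
  have : (algOf 𝒩 : Set (H →L[𝕜] H)) = ⋂ L ∈ 𝒩, ⋂ x ∈ L, {T | T x ∈ L} := by
    ext T
    simp only [Set.mem_iInter]
    rfl
  rw [this]
  exact isClosed_biInter fun L _ => isClosed_biInter fun x _ =>
    L.isClosed.preimage (ContinuousLinearMap.apply 𝕜 H x).continuous

theorem rankOne_mem_algOf {x y : H} (h : ∀ K ∈ 𝒩, x ∈ K ∨ ∀ z ∈ K, ⟪y, z⟫_𝕜 = 0) :
    rankOne 𝕜 x y ∈ algOf 𝒩 := by
  intro K hK z hz
  rw [InnerProductSpace.rankOne_apply]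
  rcases h K hK with h | h
  · exact K.toSubmodule.smul_mem _ h
  · rw [h z hz, zero_smul]
    exact K.toSubmodule.zero_mem

variable [CompleteSpace H]

instance : CompleteSpace (algOf 𝒩) := isClosed_algOf.completeSpace_coe

theorem nestProj_apply_of_mem (h𝒩 : IsNest 𝒩) (hN : N ∈ 𝒩) {x : H} (hx : x ∈ N) :
    (nestProj h𝒩 hN : H →L[𝕜] H) x = x :=
  Submodule.starProjection_eq_self_iff.mpr hx

theorem nestProj_apply_mem (h𝒩 : IsNest 𝒩) (hN : N ∈ 𝒩) (x : H) :
    (nestProj h𝒩 hN : H →L[𝕜] H) x ∈ N :=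
  Submodule.starProjection_apply_mem N.toSubmodule x

theorem inner_sub_nestProj (h𝒩 : IsNest 𝒩) (hN : N ∈ 𝒩) (x : H) {y : H} (hy : y ∈ N) :
    ⟪x - (nestProj h𝒩 hN : H →L[𝕜] H) x, y⟫_𝕜 = 0 :=
  Submodule.starProjection_inner_eq_zero x y hy

theorem inner_sub_nestProj_self (h𝒩 : IsNest 𝒩) (hN : N ∈ 𝒩) (x : H) :
    ⟪x - (nestProj h𝒩 hN : H →L[𝕜] H) x, x⟫_𝕜 =
      ⟪x - (nestProj h𝒩 hN : H →L[𝕜] H) x, x - (nestProj h𝒩 hN : H →L[𝕜] H) x⟫_𝕜 := by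
  rw [inner_sub_right _ x, inner_sub_nestProj h𝒩 hN x (nestProj_apply_mem h𝒩 hN x), sub_zero]

theorem mul_nestProj_mul_self (h𝒩 : IsNest 𝒩) (hN : N ∈ 𝒩) (T : algOf 𝒩) :
    nestProj h𝒩 hN * (T * nestProj h𝒩 hN) = T * nestProj h𝒩 hN := by
  ext x
  exact nestProj_apply_of_mem h𝒩 hN (T.2 N hN _ (nestProj_apply_mem h𝒩 hN x))

theorem nestProj_mul_self (h𝒩 : IsNest 𝒩) (hN : N ∈ 𝒩) :
    nestProj h𝒩 hN * nestProj h𝒩 hN = nestProj h𝒩 hN := by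
  simpa using mul_nestProj_mul_self h𝒩 hN 1

variable {δ : algOf 𝒩 →ₗ[𝕜] algOf 𝒩}

/-- An operator `⟪y, ·⟫ x` with `⟪y, x⟫ ≠ 0` is a scalar multiple of an idempotent. -/
theorem map_rankOne_of_inner_ne_zero (h𝒩 : IsNest 𝒩) (hN : N ∈ 𝒩)
    (hid : ∀ e : algOf 𝒩, e * e = e → e * nestProj h𝒩 hN = e → nestProj h𝒩 hN * e = e →
      nestProj h𝒩 hN * δ e = 0)
    {x y : H} (hx : x ∈ N) (hy : ∀ z, ⟪y, (nestProj h𝒩 hN : H →L[𝕜] H) z⟫_𝕜 = ⟪y, z⟫_𝕜)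
    (hxy : ⟪y, x⟫_𝕜 ≠ 0) {T : algOf 𝒩} (hT : (T : H →L[𝕜] H) = rankOne 𝕜 x y) :
    nestProj h𝒩 hN * δ T = 0 := by
  have hTz : ∀ z, (T : H →L[𝕜] H) z = ⟪y, z⟫_𝕜 • x := fun z => by rw [hT]; rfl
  have hTT : T * T = ⟪y, x⟫_𝕜 • T := by
    ext z
    simp [hTz, inner_smul_right, smul_smul, mul_comm]
  have h := hid ((⟪y, x⟫_𝕜)⁻¹ • T)
    (by rw [smul_mul_smul_comm, hTT, smul_smul, mul_assoc, inv_mul_cancel₀ hxy, mul_one])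
    (by ext z; simp [hTz, hy])
    (by ext z; simp [hTz, nestProj_apply_of_mem h𝒩 hN hx])
  rw [map_smul, mul_smul_comm] at h
  exact (smul_eq_zero.mp h).resolve_left (inv_ne_zero hxy)

/-- A linear map that is killed by `P_N` at the idempotents of the corner of `P_N` is killed at all its
rank-one operators `T = ⟪y, ·⟫ x`, since these lie in the span of the idempotents. Let `L` be the
least member of the nest containing `x`. If `y` is not orthogonal to `L`, then `T` is a scalar
multiple of an idempotent or a difference of two such; otherwise `P_L + T` is idempotent. The
condition `hy` says that `y` lies in `N`. -/
theorem map_rankOne_eq_zero (h𝒩 : IsNest 𝒩) (hN : N ∈ 𝒩)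
    (hid : ∀ e : algOf 𝒩, e * e = e → e * nestProj h𝒩 hN = e → nestProj h𝒩 hN * e = e →
      nestProj h𝒩 hN * δ e = 0)
    {x y : H} (hx : x ∈ N) (hy : ∀ z, ⟪y, (nestProj h𝒩 hN : H →L[𝕜] H) z⟫_𝕜 = ⟪y, z⟫_𝕜)
    (h : ∀ K ∈ 𝒩, x ∈ K ∨ ∀ z ∈ K, ⟪y, z⟫_𝕜 = 0)
    {T : algOf 𝒩} (hT : (T : H →L[𝕜] H) = rankOne 𝕜 x y) :
    nestProj h𝒩 hN * δ T = 0 := by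
  have hTz : ∀ z, (T : H →L[𝕜] H) z = ⟪y, z⟫_𝕜 • x := fun z => by rw [hT]; rfl
  obtain ⟨L, hL⟩ : ∃ L, L = sInf {K | K ∈ 𝒩 ∧ x ∈ K} := ⟨_, rfl⟩
  have hL𝒩 : L ∈ 𝒩 := hL ▸ h𝒩.sInf_mem _ fun K hK => hK.1
  have hxL : x ∈ L := by
    rw [hL, ClosedSubmodule.mem_sInf]
    exact fun K hK => hK.2
  have hLK : ∀ K ∈ 𝒩, x ∈ K → L ≤ K := fun K hK hxK => hL ▸ sInf_le ⟨hK, hxK⟩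
  have hLN : L ≤ N := hLK N hN hx
  have hne := fun {x : H} => map_rankOne_of_inner_ne_zero (x := x) (y := y) (δ := δ) h𝒩 hN hid
  by_cases hxy : ⟪y, x⟫_𝕜 = 0
  · by_cases hw : ∃ w ∈ L, ⟪y, w⟫_𝕜 ≠ 0
    · obtain ⟨w, hwL, hyw⟩ := hw
      have hwT : rankOne 𝕜 w y ∈ algOf 𝒩 := rankOne_mem_algOf fun K hK =>
        (h K hK).imp_left fun hxK => hLK K hK hxK hwL
      have h1 := hne (hLN hwL) hy hyw (T := ⟨_, hwT⟩) rfl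
      have h2 := hne (x := x + w) (N.toSubmodule.add_mem hx (hLN hwL)) hy
        (by rwa [inner_add_right, hxy, zero_add]) (T := T + ⟨_, hwT⟩)
        (by ext z; simp [hTz])
      rwa [map_add, mul_add, h1, add_zero] at h2
    · -- here `y` is orthogonal to `L`, and `P_L + T` is idempotent
      push Not at hw
      have hPL : ∀ z ∈ L, (nestProj h𝒩 hL𝒩 : H →L[𝕜] H) z = z := fun z hz =>
        nestProj_apply_of_mem h𝒩 hL𝒩 hz
      have hPL' := nestProj_apply_mem h𝒩 hL𝒩
      have hNL : nestProj h𝒩 hL𝒩 * nestProj h𝒩 hN = nestProj h𝒩 hL𝒩 := by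
        ext z
        have h1 := fun v hv => inner_sub_nestProj h𝒩 hN z (y := v) (hLN hv)
        have h2 : (nestProj h𝒩 hL𝒩 : H →L[𝕜] H) (z - (nestProj h𝒩 hN : H →L[𝕜] H) z) = 0 :=
          Submodule.starProjection_apply_eq_zero_iff _ |>.mpr fun v hv => by
            rw [← inner_conj_symm, h1 v hv, map_zero]
        rw [map_sub, sub_eq_zero] at h2
        exact h2.symm
      have hLN' : nestProj h𝒩 hN * nestProj h𝒩 hL𝒩 = nestProj h𝒩 hL𝒩 := by
        ext z
        exact nestProj_apply_of_mem h𝒩 hN (hLN (hPL' z))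
      have hTN : T * nestProj h𝒩 hN = T := by ext z; simp [hTz, hy]
      have hNT : nestProj h𝒩 hN * T = T := by
        ext z; simp [hTz, nestProj_apply_of_mem h𝒩 hN hx]
      have h1 := hid _ (nestProj_mul_self h𝒩 hL𝒩) hNL hLN'
      have h2 := hid (nestProj h𝒩 hL𝒩 + T) (by
          ext z
          simp [hTz, hPL _ (hPL' z), hPL x hxL, inner_add_right, inner_smul_right, hxy,
            hw _ (hPL' z)])
        (by rw [add_mul, hNL, hTN]) (by rw [mul_add, hLN', hNT])
      rwa [map_add, mul_add, h1, zero_add] at h2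
  · exact hne hx hy hxy hT

/-- The rank-one operators of the nest algebra with range in `N` separate the vectors of `N`. If a
nonzero member `K` of the nest misses `z`, take `x ∈ K` and `y = z - P_K z`; if there is none, then
`z` lies in every nonzero member and `x = y = z` will do. -/
theorem exists_rankOne_apply_ne_zero (h𝒩 : IsNest 𝒩) (hN : N ∈ 𝒩) {z : H} (hz : z ∈ N)
    (hz0 : z ≠ 0) :
    ∃ x ∈ N, ∃ y ∈ N, x ≠ 0 ∧ ⟪y, z⟫_𝕜 ≠ 0 ∧ ∀ K ∈ 𝒩, x ∈ K ∨ ∀ v ∈ K, ⟪y, v⟫_𝕜 = 0 := by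
  have key : ∀ K : ClosedSubmodule 𝕜 H, K ≠ ⊥ → ∃ x ∈ K, x ≠ 0 := by
    intro K hK
    by_contra! h
    exact hK (le_bot_iff.mp fun x hx => h x hx)
  by_cases hK : ∃ K ∈ 𝒩, K ≠ ⊥ ∧ z ∉ K
  · obtain ⟨K, hK, hK0, hzK⟩ := hK
    have hKN : K ≤ N := (h𝒩.total K hK N hN).resolve_right fun h => hzK (h hz)
    obtain ⟨x, hxK, hx0⟩ := key K hK0
    have hPz := nestProj_apply_mem h𝒩 hK z
    refine ⟨x, hKN hxK, z - (nestProj h𝒩 hK : H →L[𝕜] H) z,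
      N.toSubmodule.sub_mem hz (hKN hPz), hx0, ?_, fun K' hK' => ?_⟩
    · rw [inner_sub_nestProj_self, inner_self_ne_zero, sub_ne_zero]
      intro h
      exact hzK (h ▸ hPz)
    · exact (h𝒩.total K hK K' hK').imp (fun h => h hxK) fun h v hv =>
        inner_sub_nestProj h𝒩 hK z (h hv)
  · push Not at hK
    refine ⟨z, hz, z, hz, hz0, inner_self_ne_zero.mpr hz0, fun K h => ?_⟩
    by_cases hK0 : K = ⊥
    · right
      intro v hv
      rw [hK0, ClosedSubmodule.mem_bot] at hv
      rw [hv, inner_zero_right]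
    · exact Or.inl (hK K h hK0)

/-- A left Jordan derivation from the corner of `P_N` vanishes. For a rank-one operator `f` of the corner
the polarized square rule at `u`, `f` has a vanishing left side, as `u * f` and `f * u` have rank at
most one, and leaves `f * δ u = 0`; the rank-one operators separate vectors. -/
theorem map_corner_of_nest (h𝒩 : IsNest 𝒩) (hN : N ∈ 𝒩)
    (hsq : ∀ u, u * nestProj h𝒩 hN = u → nestProj h𝒩 hN * u = u →
      nestProj h𝒩 hN * δ (u * u) = u * δ u + u * δ u)
    {u : algOf 𝒩} (hup : u * nestProj h𝒩 hN = u) (hpu : nestProj h𝒩 hN * u = u) :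
    nestProj h𝒩 hN * δ u = 0 := by
  have hid : ∀ e : algOf 𝒩, e * e = e → e * nestProj h𝒩 hN = e → nestProj h𝒩 hN * e = e →
      nestProj h𝒩 hN * δ e = 0 := fun e =>
    mul_map_idempotent_eq_zero (δ := δ.toAddMonoidHom) hsq
  ext h
  by_contra hne
  obtain ⟨x, hx, y, hy, hx0, hyz, hadm⟩ :=
    exists_rankOne_apply_ne_zero h𝒩 hN (nestProj_apply_mem h𝒩 hN ((δ u : H →L[𝕜] H) h)) hne
  have hy' : ∀ z, ⟪y, (nestProj h𝒩 hN : H →L[𝕜] H) z⟫_𝕜 = ⟪y, z⟫_𝕜 := fun z => by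
    rw [← inner_conj_symm, ← inner_conj_symm y z, ← sub_eq_zero, ← map_sub, ← inner_sub_left,
      ← neg_sub, inner_neg_left, inner_sub_nestProj h𝒩 hN z hy, neg_zero, map_zero]
  obtain ⟨f, hf⟩ : ∃ f : algOf 𝒩, (f : H →L[𝕜] H) = rankOne 𝕜 x y :=
    ⟨⟨_, rankOne_mem_algOf hadm⟩, rfl⟩
  have hfz : ∀ z, (f : H →L[𝕜] H) z = ⟪y, z⟫_𝕜 • x := fun z => by rw [hf]; rfl
  have hfp : f * nestProj h𝒩 hN = f := by ext z; simp [hfz, hy']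
  have hpf : nestProj h𝒩 hN * f = f := by ext z; simp [hfz, nestProj_apply_of_mem h𝒩 hN hx]
  have hux : (u : H →L[𝕜] H) x ∈ N := u.2 N hN x hx
  have h1 : nestProj h𝒩 hN * δ f = 0 := map_rankOne_eq_zero h𝒩 hN hid hx hy' hadm hf
  have h2 : nestProj h𝒩 hN * δ (u * f) = 0 :=
    map_rankOne_eq_zero h𝒩 hN hid hux hy' (fun K hK => (hadm K hK).imp_left (u.2 K hK x))
      (by ext z; simp [hfz])
  have h3 : nestProj h𝒩 hN * δ (f * u) = 0 := by
    refine map_rankOne_eq_zero h𝒩 hN hid hx (y := ContinuousLinearMap.adjoint (u : H →L[𝕜] H) y)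
      (fun z => ?_) (fun K hK => (hadm K hK).imp_right fun h v hv => ?_) ?_
    · rw [ContinuousLinearMap.adjoint_inner_left, ContinuousLinearMap.adjoint_inner_left]
      exact congrArg (fun T : algOf 𝒩 => ⟪y, (T : H →L[𝕜] H) z⟫_𝕜) hup
    · rw [ContinuousLinearMap.adjoint_inner_left]
      exact h _ (u.2 K hK v hv)
    · ext z
      simp [hfz, ContinuousLinearMap.adjoint_inner_left]
  have h4 := mul_map_jordan (δ := δ.toAddMonoidHom) hsq hup hpu hfp hpf
  have h5 : u * δ f = 0 := by rw [← hup, mul_assoc, h1, mul_zero]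
  simp only [LinearMap.toAddMonoidHom_coe, map_add, mul_add, h2, h3, h5, add_zero, zero_add] at h4
  rw [← two_smul 𝕜] at h4
  have h6 := (smul_eq_zero.mp h4.symm).resolve_left two_ne_zero
  rw [← hfp, mul_assoc] at h6
  have h7 : (f : H →L[𝕜] H) ((nestProj h𝒩 hN : H →L[𝕜] H) ((δ u : H →L[𝕜] H) h)) = 0 :=
    congrArg (fun T : algOf 𝒩 => (T : H →L[𝕜] H) h) h6
  rw [hfz] at h7
  exact (smul_ne_zero hyz hx0) h7

/-- Every operator from the orthogonal complement of `N` into `N` belongs to the nest algebra, so these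
operators separate the vectors of the complement. -/
theorem nestProj_complement_faithful (h𝒩 : IsNest 𝒩) (hN : N ∈ 𝒩) (hN_bot : N ≠ ⊥)
    (b : algOf 𝒩) (hb : ∀ a, nestProj h𝒩 hN * a * (1 - nestProj h𝒩 hN) * b = 0) :
    (1 - nestProj h𝒩 hN) * b = 0 := by
  obtain ⟨x, hx, hx0⟩ : ∃ x ∈ N, x ≠ 0 := by
    by_contra! h
    exact hN_bot (le_bot_iff.mp fun x hx => h x hx)
  ext h
  by_contra hne
  obtain ⟨y, hy⟩ : ∃ y, y = (b : H →L[𝕜] H) h - (nestProj h𝒩 hN : H →L[𝕜] H) ((b : H →L[𝕜] H) h) :=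
    ⟨_, rfl⟩
  have hy0 : y ≠ 0 := by
    rw [hy]
    simpa using hne
  have hmem : rankOne 𝕜 x y ∈ algOf 𝒩 := rankOne_mem_algOf fun K hK =>
    (h𝒩.total N hN K hK).imp (fun h => h hx) fun h v hv => by
      rw [hy]
      exact inner_sub_nestProj h𝒩 hN _ (h hv)
  have h1 := congrArg (fun T : algOf 𝒩 => (T : H →L[𝕜] H) h) (hb ⟨_, hmem⟩)
  have h2 : ⟪y, y⟫_𝕜 • x = 0 := by
    simpa [← hy, nestProj_apply_of_mem h𝒩 hN hx] using h1
  exact smul_ne_zero (inner_self_ne_zero.mpr hy0) hx0 h2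

end Nest

/-! ### The characterization -/

theorem corollary2p9 {𝕜 H : Type*} [RCLike 𝕜] [NormedAddCommGroup H] [InnerProductSpace 𝕜 H]
    [CompleteSpace H] {𝒩 : Set (ClosedSubmodule 𝕜 H)} (h𝒩 : IsNest 𝒩)
    {N : ClosedSubmodule 𝕜 H} (hN : N ∈ 𝒩) (hN_bot : N ≠ ⊥) (hN_top : N ≠ ⊤)
    (δ : algOf 𝒩 →L[𝕜] algOf 𝒩) :
    (∀ A B : algOf 𝒩, A * B + B * A = nestProj h𝒩 hN →
        2 * A * δ B + 2 * B * δ A = δ (nestProj h𝒩 hN)) ↔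
      (∀ A : algOf 𝒩, δ A = A * δ 1) ∧ nestProj h𝒩 hN * δ 1 = 0 := by
  have hp := nestProj_mul_self h𝒩 hN
  constructor
  · intro h
    have hδ' : ∀ A B : algOf 𝒩, A * B + B * A = nestProj h𝒩 hN + nestProj h𝒩 hN →
        A * δ B + B * δ A = δ (nestProj h𝒩 hN) := by
      intro A B hAB
      have h1 := h A ((2⁻¹ : 𝕜) • B) (by
        rw [mul_smul_comm, smul_mul_assoc, ← smul_add, hAB, ← two_smul 𝕜, smul_smul,
          inv_mul_cancel₀ two_ne_zero, one_smul])
      have h2 : (2⁻¹ + 2⁻¹ : 𝕜) = 1 := by norm_num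
      rw [map_smul, two_mul, two_mul, ← add_smul, h2, one_smul, mul_smul_comm, add_mul, smul_add,
        ← add_smul, h2, one_smul] at h1
      exact h1
    have h0 : δ (nestProj h𝒩 hN) = 0 :=
      map_idempotent_eq_zero (δ := (δ : algOf 𝒩 →ₗ[𝕜] algOf 𝒩).toAddMonoidHom) hp hδ'
    have hδ : ∀ A B : algOf 𝒩, A * B + B * A = nestProj h𝒩 hN + nestProj h𝒩 hN →
        A * δ B + B * δ A = 0 := fun A B hAB => (hδ' A B hAB).trans h0
    have hsq := fun u => mul_map_sq (δ := (δ : algOf 𝒩 →ₗ[𝕜] algOf 𝒩)) (u := u) hp hδ h0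
    have hPδ := fun u => map_corner_of_nest h𝒩 hN (u := u) hsq
    exact map_eq_mul_map_one (δ := (δ : algOf 𝒩 →ₗ[𝕜] algOf 𝒩).toAddMonoidHom) hp
      (mul_nestProj_mul_self h𝒩 hN) (nestProj_complement_faithful h𝒩 hN hN_bot) hδ
      fun u => map_corner_eq_zero hp hδ hPδ h0
  · rintro ⟨h, h1⟩ A B hAB
    rw [h A, h B, h (nestProj h𝒩 hN), h1, mul_assoc 2, mul_assoc 2, ← mul_add, ← mul_assoc,
      ← mul_assoc, ← add_mul, hAB, h1, mul_zero]
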